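/- Let $X=(X,d,\mu)$ be a metric space with at least two points, equipped with (the completion of) a Borel measure $\mu$ such that $0<\mu(B)<\infty$ for every open ball $B=B(x,r)$, $x\in X$, $r>0$, and such that $\mu$ is doubling: there is a constant $c_\mu>1$ with $\mu(B(x,2r))\le c_\mu\,\mu(B(x,r))$ for all $x\in X$ and $r>0$. Measurability of functions is understood with respect to the completion of $\mu$. Curves in $X$ are nonconstant, rectifiable and parametrized by arc length. Definitions. Let $1\le s<\infty$. (a) A measurable $g\colon X\to[0,\infty]$ is an $s$-weak upper gradient of $u\colon X\to\mathbb R$ if there is a Borel function $\rho\colon X\to[0,\infty]$ with $\rho\in L^s_{\mathrm{loc}}(X)$ (every point has a ball around it over which $\rho^s$ has finite integral) such that $\int_\gamma\rho\,ds=\infty$ for every curve $\gamma$, with endpoints $x,y$, for which $|u(x)-u(y)|\le\int_\gamma g\,ds$ fails. (b) $X$ supports an $s$-Poincaré inequality if there are constants $C_P>0$ and $\lambda\ge1$ such that for all balls $B=B(x,r)$, all measurable $u\colon X\to\mathbb R$ and all $s$-weak upper gradients $g$ of $u$, $$\frac1{\mu(B)}\int_B|u-u_B|\,d\mu\le C_P\operatorname{diam}(B)\Bigl(\frac1{\mu(\lambda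 B)}\int_{\lambda B}g^s\,d\mu\Bigr)^{1/s},\qquad u_B=\frac1{\mu(B)}\int_Bu\,d\mu,\quad \lambda B=B(x,\lambda r),$$ where the left-hand side is read as $\infty$ if $u$ is not integrable over $B$. (c) A measurable $g\colon X\to[0,\infty]$ is a Hajłasz $1$-gradient of $u\colon X\to\mathbb R$ if there is a set $N$ with $\mu(N)=0$ and $|u(x)-u(y)|\le d(x,y)\,(g(x)+g(y))$ for all $x,y\in X\setminus N$. (d) For a bounded open set $\Omega\subset X$ and a closed subset $F\subset\Omega$, let $\operatorname{cap}_{1,s}(F,\Omega)=\inf_u\inf_g\int_Xg^s\,d\mu$, where $u$ runs over all Lipschitz functions $u\colon X\to\mathbb R$ with $u\ge1$ on $F$ and $u=0$ on $X\setminus\Omega$, and $g$ over all Hajłasz $1$-gradients of $u$; and let $\operatorname{cap}_s(F,\Omega)=\inf_u\inf_g\int_\Omega g^s\,d\mu$, where $u$ runs over the same functions and $g$ over all $s$-weak upper gradients of $u$. Both are $\infty$ if there is no such $u$. (e) A closed set $E\subset X$ satisfies the Hajłasz $(1,s)$-capacity density condition if there is a constant $c_0>0$ such that $$\operatorname{cap}_{1,s}\bigl(E\cap\overline{B(x,r)},B(x,2r)\bigr)\ge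 c_0\operatorname{cap}_{1,s}\bigl(\overline{B(x,r)},B(x,2r)\bigr)$$ for all $x\in E$ and all $0<r<\tfrac18\operatorname{diam}(E)$, where $\overline{B(x,r)}$ is the closure of $B(x,r)$ and $\operatorname{diam}(E)\in[0,\infty]$. It satisfies the $s$-capacity density condition if the same holds with $\operatorname{cap}_s$ in place of $\operatorname{cap}_{1,s}$. Corollary. Let $1\le q<p<\infty$ and assume that $X$ supports a $q$-Poincaré inequality. Then a closed set $E\subset X$ satisfies the Hajłasz $(1,p)$-capacity density condition if and only if it satisfies the $p$-capacity density condition. -/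

import Mathlib

open Set Metric MeasureTheory
open scoped NNReal ENNReal

/-- The measure is positive and finite on all balls (of positive radius). -/
def PosFiniteOnBalls {X : Type*} [MetricSpace X] [MeasurableSpace X] (μ : Measure X) : Prop :=
  ∀ (x : X) (r : ℝ), 0 < r → 0 < μ (ball x r) ∧ μ (ball x r) < ∞

/-- The measure is (globally) doubling: `μ(2B) ≤ c_μ μ(B)` for all balls `B`, for a constant
`c_μ > 1`. -/
def IsDoublingOnBalls {X : Type*} [MetricSpace X] [MeasurableSpace X] (μ : Measure X) : Prop :=
  ∃ c : ℝ≥0, 1 < c ∧ ∀ (x : X) (r : ℝ), 0 < r → μ (ball x (2 * r)) ≤ c * μ (ball x r)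

/-- `u ∈ Lip_β(X)`: `u` is a `β`-Hölder function on the whole space, with some finite constant.
For `β = 1` these are the Lipschitz functions. -/
def IsHolderFun {X : Type*} [MetricSpace X] (β : ℝ≥0) (u : X → ℝ) : Prop :=
  ∃ K : ℝ≥0, HolderWith K β u

/-- `g` is a Hajłasz `β`-gradient of `u`: `|u(x) - u(y)| ≤ d(x,y)^β (g(x) + g(y))` for all `x, y`
outside a set of measure zero. Measurability is with respect to the completion of `μ`, which is
what `AEMeasurable` says. -/
def IsHajlaszGradient {X : Type*} [MetricSpace X] [MeasurableSpace X] (μ : Measure X)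
    (β : ℝ≥0) (u : X → ℝ) (g : X → ℝ≥0∞) : Prop :=
  AEMeasurable g μ ∧ ∃ N : Set X, μ N = 0 ∧ ∀ x ∉ N, ∀ y ∉ N,
    ENNReal.ofReal |u x - u y| ≤ edist x y ^ (β : ℝ) * (g x + g y)

/-- The variational Hajłasz `(β, p)`-capacity of `F` relative to `Ω`. The infimum over the empty
family is `∞`. -/
noncomputable def hajlaszCapacity {X : Type*} [MetricSpace X] [MeasurableSpace X]
    (μ : Measure X) (β : ℝ≥0) (p : ℝ) (F Ω : Set X) : ℝ≥0∞ :=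
  ⨅ (u : X → ℝ) (_ : IsHolderFun β u ∧ (∀ x ∈ F, 1 ≤ u x) ∧ ∀ x ∉ Ω, u x = 0)
    (g : X → ℝ≥0∞) (_ : IsHajlaszGradient μ β u g), ∫⁻ x, g x ^ p ∂μ

/-- `γ`, restricted to `[0, L]`, is a nonconstant rectifiable curve parametrized by its
arc length: for `0 ≤ s ≤ t ≤ L` the length of `γ` on `[s, t]` equals `t - s`. -/
def IsArcLengthCurve {X : Type*} [MetricSpace X] (L : ℝ) (γ : ℝ → X) : Prop :=
  0 < L ∧ HasUnitSpeedOn γ (Icc 0 L)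

/-- The path integral `∫_γ g ds` along a curve parametrized by arc length on `[0, L]`. -/
noncomputable def arcLengthIntegral {X : Type*} (L : ℝ) (γ : ℝ → X) (g : X → ℝ≥0∞) : ℝ≥0∞ :=
  ∫⁻ t in Icc 0 L, g (γ t)

/-- `ρ` belongs to `L^p_loc(X)`: each point has a ball around it on which `ρ^p` has finite
integral. -/
def IsLocallyLp {X : Type*} [MetricSpace X] [MeasurableSpace X] (μ : Measure X) (p : ℝ)
    (ρ : X → ℝ≥0∞) : Prop :=
  ∀ x : X, ∃ r : ℝ, 0 < r ∧ ∫⁻ y in ball x r, ρ y ^ p ∂μ < ∞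

/-- `g` is a `p`-weak upper gradient of `u`: `|u(x) - u(y)| ≤ ∫_γ g ds` for all curves `γ` joining
`x` to `y`, except for curves with `∫_γ ρ ds = ∞`, where `ρ` is a single Borel function in
`L^p_loc(X)`. -/
def IsWeakUpperGradient {X : Type*} [MetricSpace X] [MeasurableSpace X] (μ : Measure X)
    (p : ℝ) (u : X → ℝ) (g : X → ℝ≥0∞) : Prop :=
  AEMeasurable g μ ∧ ∃ ρ : X → ℝ≥0∞, Measurable ρ ∧ IsLocallyLp μ p ρ ∧
    ∀ (L : ℝ) (γ : ℝ → X), IsArcLengthCurve L γ →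
      ¬ ENNReal.ofReal |u (γ 0) - u (γ L)| ≤ arcLengthIntegral L γ g → arcLengthIntegral L γ ρ = ∞

open Classical in
/-- The mean oscillation of `u` over `B`, that is, the average over `B` of `|u - u_B|`; it is `∞`
if `u` is not integrable over `B`. -/
noncomputable def meanOscillation {X : Type*} [MeasurableSpace X] (μ : Measure X)
    (u : X → ℝ) (B : Set X) : ℝ≥0∞ :=
  if IntegrableOn u B μ then ⨍⁻ x in B, ENNReal.ofReal |u x - ⨍ y in B, u y ∂μ| ∂μ else ∞

/-- The space supports a `p`-Poincaré inequality. -/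
def SupportsPoincare {X : Type*} [MetricSpace X] [MeasurableSpace X] (μ : Measure X)
    (p : ℝ) : Prop :=
  ∃ (C : ℝ≥0) (l : ℝ), 0 < C ∧ 1 ≤ l ∧
    ∀ (x : X) (r : ℝ), 0 < r → ∀ u : X → ℝ, AEMeasurable u μ →
      ∀ g : X → ℝ≥0∞, IsWeakUpperGradient μ p u g →
        meanOscillation μ u (ball x r) ≤
          C * ediam (ball x r) * (⨍⁻ y in ball x (l * r), g y ^ p ∂μ) ^ (1 / p)

/-- The variational `p`-capacity of `F` relative to `Ω`. The infimum over the empty family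
is `∞`. -/
noncomputable def variationalCapacity {X : Type*} [MetricSpace X] [MeasurableSpace X]
    (μ : Measure X) (p : ℝ) (F Ω : Set X) : ℝ≥0∞ :=
  ⨅ (u : X → ℝ) (_ : (∃ K : ℝ≥0, LipschitzWith K u) ∧ (∀ x ∈ F, 1 ≤ u x) ∧ ∀ x ∉ Ω, u x = 0)
    (g : X → ℝ≥0∞) (_ : IsWeakUpperGradient μ p u g), ∫⁻ x in Ω, g x ^ p ∂μ

/-- The Hajłasz `(β, p)`-capacity density condition for the (closed) set `E`. -/
def HajlaszCapacityDensity {X : Type*} [MetricSpace X] [MeasurableSpace X] (μ : Measure X)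
    (β : ℝ≥0) (p : ℝ) (E : Set X) : Prop :=
  ∃ c : ℝ≥0, 0 < c ∧ ∀ x ∈ E, ∀ r : ℝ, 0 < r → ENNReal.ofReal r < ediam E / 8 →
    c * hajlaszCapacity μ β p (closure (ball x r)) (ball x (2 * r)) ≤
      hajlaszCapacity μ β p (E ∩ closure (ball x r)) (ball x (2 * r))

/-- The `p`-capacity density condition for the (closed) set `E`. -/
def VariationalCapacityDensity {X : Type*} [MetricSpace X] [MeasurableSpace X] (μ : Measure X)
    (p : ℝ) (E : Set X) : Prop :=
  ∃ c : ℝ≥0, 0 < c ∧ ∀ x ∈ E, ∀ r : ℝ, 0 < r → ENNReal.ofReal r < ediam E / 8 →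
    c * variationalCapacity μ p (closure (ball x r)) (ball x (2 * r)) ≤
      variationalCapacity μ p (E ∩ closure (ball x r)) (ball x (2 * r))

/-! The two capacities are comparable up to constants independent of the sets, and comparable
capacities have equivalent density conditions. Both run over the same Lipschitz functions `u`, so it
suffices to trade one kind of gradient of `u` for the other at bounded cost in the `L^p` norm.

From Hajłasz to upper gradients (`variationalCapacity_le_hajlaszCapacity`): after a null
modification, twice a Hajłasz gradient is a weak upper gradient. Along a curve spending zero time in
the exceptional null set, averaging the Hajłasz inequality over pairs of times at distance `δ` and
letting `δ` tend to zero gives the bound. The other curves are excluded by the Borel function equal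
to `∞` on a null set.

From upper to Hajłasz gradients (`exists_hajlaszCapacity_le_variationalCapacity`): since `u`
vanishes off the open set `Ω`, an upper gradient may be cut off to zero there. The `q`-Poincaré
inequality bounds the mean oscillation of `u` on each ball centred at `x` by the radius times `M(g ^
q)(x) ^ (1 / q)`, with `M` the maximal function. Telescoping over shrinking balls makes a multiple
of this function a Hajłasz gradient. As `p / q > 1`, the Hardy–Littlewood theorem bounds its `L^p`
norm by that of `g`. -/

/-! ### Hajłasz gradients on an interval -/

/-- A continuous function on `[0, L]` with Hajłasz gradient `h` (off a null set) has
`2 h` as an upper gradient. -/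
theorem ofReal_abs_sub_le_lintegral_of_hajlasz {L : ℝ} (hL : 0 < L) {v : ℝ → ℝ}
    (hv : Continuous v) {h : ℝ → ℝ≥0∞} (hh : Measurable h) {S : Set ℝ}
    (hS : volume (S ∩ Icc 0 L) = 0)
    (hvh : ∀ s ∈ Icc 0 L, s ∉ S → ∀ t ∈ Icc 0 L, t ∉ S →
      ENNReal.ofReal |v s - v t| ≤ ENNReal.ofReal |s - t| * (h s + h t)) :
    ENNReal.ofReal |v 0 - v L| ≤ 2 * ∫⁻ t in Icc 0 L, h t := by
  -- The endpoints may lie in `S`, so `v 0` and `v L` are replaced by integrals over end windows of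
  -- length `δ`. Their difference is the integral of `v (t + δ) - v t`, to which the hypothesis
  -- applies for almost every `t`, with a factor `δ`.
  have key : ∀ δ, 0 < δ → δ < L →
      ENNReal.ofReal |(∫ t in (L - δ)..L, v t) - ∫ t in (0 : ℝ)..δ, v t| ≤
        ENNReal.ofReal δ * (2 * ∫⁻ t in Icc 0 L, h t) := by
    intro δ hδ hδL
    have hi : ∀ a b, IntervalIntegrable v volume a b := fun a b => hv.intervalIntegrable a b
    have hi' : IntervalIntegrable (fun t => v (t + δ)) volume 0 (L - δ) :=
      (hv.comp (continuous_add_const δ)).intervalIntegrable _ _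
    have e1 : (∫ t in (L - δ)..L, v t) - ∫ t in (0 : ℝ)..δ, v t =
        ∫ t in (0 : ℝ)..(L - δ), (v (t + δ) - v t) := by
      rw [intervalIntegral.integral_sub hi' (hi _ _), intervalIntegral.integral_comp_add_right,
        zero_add, sub_add_cancel]
      have h1 := intervalIntegral.integral_add_adjacent_intervals (hi δ (L - δ)) (hi (L - δ) L)
      have h2 := intervalIntegral.integral_add_adjacent_intervals (hi 0 δ) (hi δ (L - δ))
      linarith
    rw [e1, intervalIntegral.integral_of_le (by linarith), ← Real.norm_eq_abs,
      ofReal_norm]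
    refine (enorm_integral_le_lintegral_enorm _).trans ?_
    have hnull : ∀ᵐ t : ℝ, (t ∈ Icc 0 L → t ∉ S) ∧ (t + δ ∈ Icc 0 L → t + δ ∉ S) := by
      have h1 : ∀ᵐ t : ℝ, t ∈ Icc 0 L → t ∉ S := by
        refine measure_mono_null ?_ hS
        intro t ht
        simp only [mem_compl_iff, mem_ofPred_eq, not_forall, not_not] at ht
        exact ⟨ht.2, ht.1⟩
      exact h1.and ((measurePreserving_add_right volume δ).quasiMeasurePreserving.ae h1)
    calc ∫⁻ t in Ioc 0 (L - δ), ‖v (t + δ) - v t‖ₑ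
        ≤ ∫⁻ t in Ioc 0 (L - δ), ENNReal.ofReal δ * (h (t + δ) + h t) := by
          refine setLIntegral_mono_ae' measurableSet_Ioc ?_
          filter_upwards [hnull] with t ht hmem
          have m1 : t ∈ Icc 0 L := ⟨hmem.1.le, by linarith [hmem.2]⟩
          have m2 : t + δ ∈ Icc 0 L := ⟨by linarith [hmem.1], by linarith [hmem.2]⟩
          have := hvh _ m2 (ht.2 m2) _ m1 (ht.1 m1)
          rwa [add_sub_cancel_left, abs_of_pos hδ, ← Real.norm_eq_abs (v _ - _),
            ofReal_norm] at this
      _ = ENNReal.ofReal δ * ((∫⁻ t in Ioc 0 (L - δ), h (t + δ)) +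
            ∫⁻ t in Ioc 0 (L - δ), h t) := by
          rw [lintegral_const_mul _ (by fun_prop), lintegral_add_right _ hh]
      _ ≤ ENNReal.ofReal δ * (2 * ∫⁻ t in Icc 0 L, h t) := by
          rw [two_mul]
          gcongr ENNReal.ofReal δ * (?_ + ?_)
          · have : ∫⁻ t in Ioc 0 (L - δ), h (t + δ) = ∫⁻ t in Ioc δ L, h t := by
              rw [← (measurePreserving_add_right volume δ).setLIntegral_comp_preimage
                measurableSet_Ioc hh]
              congr 2
              simp
            rw [this]
            exact lintegral_mono_set fun t ht => ⟨by linarith [ht.1], ht.2⟩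
          · exact lintegral_mono_set fun t ht => ⟨ht.1.le, by linarith [ht.2]⟩
  -- By continuity the means of `v` over the two windows are within `ε / 2` of `v 0` and `v L` for
  -- small `δ`; dividing `key` by `δ` then costs only `ε`.
  refine ENNReal.le_of_forall_pos_le_add fun ε hε hfin => ?_
  have hε' : (0 : ℝ) < (ε : ℝ) / 2 := by positivity
  obtain ⟨δ₁, hδ₁, H₁⟩ := Metric.continuous_iff.1 hv 0 _ hε'
  obtain ⟨δ₂, hδ₂, H₂⟩ := Metric.continuous_iff.1 hv L _ hε'
  obtain ⟨δ, hδ, hδm⟩ := exists_between (lt_min (lt_min hδ₁ hδ₂) hL)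
  simp only [lt_min_iff] at hδm
  obtain ⟨⟨hd1, hd2⟩, hd3⟩ := hδm
  have b1 : ∀ a b c : ℝ, a ≤ b → (∀ t ∈ Icc a b, |v t - c| ≤ ε / 2) →
      |(∫ t in a..b, v t) - (b - a) * c| ≤ ε / 2 * (b - a) := by
    intro a b c hab hc
    have := intervalIntegral.norm_integral_le_of_norm_le_const (a := a) (b := b)
      (f := fun t => v t - c) (C := ε / 2)
      (fun t ht => hc t (by rw [uIoc_of_le hab] at ht; exact ⟨ht.1.le, ht.2⟩))
    rw [intervalIntegral.integral_sub (hv.intervalIntegrable _ _) (by simp)] at this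
    simpa [abs_of_nonneg (sub_nonneg.2 hab)] using this
  have c1 := b1 0 δ (v 0) hδ.le fun t ht => by
    refine (H₁ t ?_).le
    rw [Real.dist_eq, sub_zero, abs_of_nonneg ht.1]; linarith [ht.2]
  have c2 := b1 (L - δ) L (v L) (by linarith) fun t ht => by
    refine (H₂ t ?_).le
    rw [Real.dist_eq, abs_sub_comm, abs_of_nonneg (by linarith [ht.2])]; linarith [ht.1]
  have k := key δ hδ hd3
  set I := 2 * ∫⁻ t in Icc 0 L, h t with hI
  by_cases hItop : I = ∞
  · simp [hItop]
  have k' : |(∫ t in (L - δ)..L, v t) - ∫ t in (0 : ℝ)..δ, v t| ≤ δ * I.toReal := by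
    have := ENNReal.toReal_mono (ENNReal.mul_ne_top ENNReal.ofReal_ne_top hItop) k
    rwa [ENNReal.toReal_ofReal (abs_nonneg _), ENNReal.toReal_mul,
      ENNReal.toReal_ofReal hδ.le] at this
  have fin : δ * |v 0 - v L| ≤ δ * (I.toReal + ε) := by
    rw [← abs_of_pos hδ, ← abs_mul, abs_of_pos hδ]
    rw [abs_le] at *
    constructor <;> nlinarith [c1.1, c1.2, c2.1, c2.2, k'.1, k'.2]
  have fin' := le_of_mul_le_mul_left fin hδ
  refine (ENNReal.ofReal_le_ofReal fin').trans ?_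
  rw [ENNReal.ofReal_add ENNReal.toReal_nonneg ε.coe_nonneg, ENNReal.ofReal_toReal hItop,
    ENNReal.ofReal_coe_nnreal]

theorem arcLengthIntegral_subcurve {X : Type*} (γ : ℝ → X) (g : X → ℝ≥0∞) (a b : ℝ) :
    arcLengthIntegral (b - a) (fun t => γ (t + a)) g = ∫⁻ t in Icc a b, g (γ t) := by
  rw [arcLengthIntegral, ← (measurePreserving_add_right volume a).setLIntegral_comp_preimage_emb
    (measurableEmbedding_addRight a) (fun t => g (γ t)) (Icc a b)]
  congr 2
  simp

/-! ### Curves and weak upper gradients -/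

section Curves

variable {X : Type*} [MetricSpace X]

theorem IsArcLengthCurve.edist_le {L : ℝ} {γ : ℝ → X} (hγ : IsArcLengthCurve L γ) {s t : ℝ}
    (hs : s ∈ Icc 0 L) (ht : t ∈ Icc 0 L) :
    edist (γ s) (γ t) ≤ ENNReal.ofReal |s - t| := by
  wlog hst : s ≤ t generalizing s t
  · rw [edist_comm, abs_sub_comm]
    exact this ht hs (le_of_not_ge hst)
  have h := hγ.2 hs ht
  rw [NNReal.coe_one, one_mul] at h
  rw [abs_sub_comm, abs_of_nonneg (sub_nonneg.2 hst), ← h]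
  exact eVariationOn.edist_le _ ⟨hs, left_mem_Icc.2 hst⟩ ⟨ht, right_mem_Icc.2 hst⟩

theorem IsArcLengthCurve.lipschitzOnWith {L : ℝ} {γ : ℝ → X} (hγ : IsArcLengthCurve L γ) :
    LipschitzOnWith 1 γ (Icc 0 L) := by
  intro s hs t ht
  rw [ENNReal.coe_one, one_mul, edist_dist s t, Real.dist_eq]
  exact hγ.edist_le hs ht

/-- A subcurve of an arc length parametrized curve, translated to start at time `0`. -/
theorem IsArcLengthCurve.subcurve {L : ℝ} {γ : ℝ → X} (hγ : IsArcLengthCurve L γ) {a b : ℝ}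
    (ha : 0 ≤ a) (hab : a < b) (hb : b ≤ L) : IsArcLengthCurve (b - a) fun t => γ (t + a) := by
  refine ⟨sub_pos.2 hab, fun x hx y hy => ?_⟩
  have h := hγ.2 (x := x + a) ⟨by linarith [hx.1], by linarith [hx.2]⟩ (y := y + a)
    ⟨by linarith [hy.1], by linarith [hy.2]⟩
  rw [add_sub_add_right_eq_sub] at h
  rw [← h]
  have := eVariationOn.comp_eq_of_monotoneOn γ (fun t => t + a)
    (t := Icc 0 (b - a) ∩ Icc x y) (fun s _ t _ hst => by simpa using hst)
  rw [show (γ ∘ fun t => t + a) = fun t => γ (t + a) from rfl] at this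
  rw [this]
  congr 1
  ext t
  simp only [mem_image, mem_inter_iff, mem_Icc] at *
  constructor
  · rintro ⟨s, hs, rfl⟩
    refine ⟨⟨?_, ?_⟩, ?_, ?_⟩ <;> linarith
  · rintro ⟨_, h1, h2⟩
    refine ⟨t - a, ⟨⟨?_, ?_⟩, ?_, ?_⟩, ?_⟩ <;> linarith

/-- If `|u(x) - u(y)| ≤ ∫_γ g` for all curves with `∫_γ ρ < ∞`, the inequality extends to
subcurves. -/
theorem ofReal_abs_sub_le_of_subcurve {u : X → ℝ} {g ρ : X → ℝ≥0∞}
    (h : ∀ (L : ℝ) (γ : ℝ → X), IsArcLengthCurve L γ →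
      ¬ ENNReal.ofReal |u (γ 0) - u (γ L)| ≤ arcLengthIntegral L γ g →
        arcLengthIntegral L γ ρ = ∞)
    {L : ℝ} {γ : ℝ → X} (hγ : IsArcLengthCurve L γ) (hρ : arcLengthIntegral L γ ρ ≠ ∞)
    {a b : ℝ} (ha : 0 ≤ a) (hab : a ≤ b) (hb : b ≤ L) :
    ENNReal.ofReal |u (γ a) - u (γ b)| ≤ ∫⁻ t in Icc a b, g (γ t) := by
  rcases hab.eq_or_lt with rfl | hab
  · simp
  by_contra hcon
  have := h (b - a) (fun t => γ (t + a)) (hγ.subcurve ha hab hb)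
  rw [arcLengthIntegral_subcurve, arcLengthIntegral_subcurve] at this
  simp only [zero_add, sub_add_cancel] at this
  refine hρ (top_le_iff.1 ?_)
  rw [← this hcon]
  exact lintegral_mono_set (Icc_subset_Icc ha hb)

variable [MeasurableSpace X] {μ : Measure X}

/-- Weak upper gradients with respect to a larger exponent are weak upper gradients with respect
to a smaller one. -/
theorem IsWeakUpperGradient.mono_exponent (hball : PosFiniteOnBalls μ) {p q : ℝ} (hq : 0 ≤ q)
    (hqp : q ≤ p) {u : X → ℝ} {g : X → ℝ≥0∞} (hg : IsWeakUpperGradient μ p u g) :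
    IsWeakUpperGradient μ q u g := by
  obtain ⟨hgm, ρ, hρm, hρ, H⟩ := hg
  refine ⟨hgm, ρ, hρm, fun x => ?_, H⟩
  obtain ⟨r, hr, hfin⟩ := hρ x
  refine ⟨r, hr, ?_⟩
  calc ∫⁻ y in ball x r, ρ y ^ q ∂μ ≤ ∫⁻ y in ball x r, (1 + ρ y ^ p) ∂μ := by
        refine lintegral_mono fun y => ?_
        rcases le_total (ρ y) 1 with h | h
        · exact (ENNReal.rpow_le_one h hq).trans le_self_add
        · exact (ENNReal.rpow_le_rpow_of_exponent_le h hqp).trans le_add_self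
    _ = μ (ball x r) + ∫⁻ y in ball x r, ρ y ^ p ∂μ := by
        rw [lintegral_add_left measurable_const]; simp
    _ < ∞ := ENNReal.add_lt_top.2 ⟨(hball x r hr).2, hfin⟩

variable [BorelSpace X]

/-- A weak upper gradient of a function vanishing outside an open set may be set to zero outside
this set. -/
theorem IsWeakUpperGradient.indicator {p : ℝ} {u : X → ℝ} {g : X → ℝ≥0∞}
    (hg : IsWeakUpperGradient μ p u g) {Ω : Set X} (hΩ : IsOpen Ω) (hu : ∀ x ∉ Ω, u x = 0) :
    IsWeakUpperGradient μ p u (Ω.indicator g) := by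
  obtain ⟨hgm, ρ, hρm, hρ, H⟩ := hg
  refine ⟨hgm.indicator hΩ.measurableSet, ρ, hρm, hρ, fun L γ hγ => ?_⟩
  contrapose!
  intro hfin
  have hL := hγ.1
  have sub := fun {a b : ℝ} => ofReal_abs_sub_le_of_subcurve H hγ hfin (a := a) (b := b)
  -- If the curve leaves `Ω`, let `a` and `b` be the first and last times outside. There `u`
  -- vanishes, so only the pieces before `a` and after `b`, both inside `Ω`, matter.
  set A : Set ℝ := Icc 0 L ∩ γ ⁻¹' Ωᶜ with hA
  have hAc : IsCompact A := isCompact_Icc.of_isClosed_subset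
    (hγ.lipschitzOnWith.continuousOn.preimage_isClosed_of_isClosed isClosed_Icc hΩ.isClosed_compl)
    inter_subset_left
  have hout : ∀ t ∈ Icc 0 L, t ∉ A → Ω.indicator g (γ t) = g (γ t) := fun t ht htA =>
    indicator_of_mem (by by_contra h; exact htA ⟨ht, h⟩) _
  rw [arcLengthIntegral]
  rcases A.eq_empty_or_nonempty with hAe | hAne
  · rw [setLIntegral_congr_fun measurableSet_Icc fun t ht => hout t ht (by simp [hAe])]
    exact sub le_rfl hL.le le_rfl
  obtain ⟨a, haA, ha⟩ := hAc.exists_isLeast hAne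
  obtain ⟨b, hbA, hb⟩ := hAc.exists_isGreatest hAne
  have hab : a ≤ b := ha hbA
  have h1 := sub le_rfl haA.1.1 haA.1.2
  have h2 := sub hbA.1.1 hbA.1.2 le_rfl
  -- The times `a` and `b` are dropped because the cut-off function need not agree with `g` there.
  rw [hu _ haA.2, sub_zero, setLIntegral_congr Ico_ae_eq_Icc.symm] at h1
  rw [hu _ hbA.2, zero_sub, abs_neg, setLIntegral_congr Ioc_ae_eq_Icc.symm] at h2
  calc ENNReal.ofReal |u (γ 0) - u (γ L)|
      ≤ ENNReal.ofReal |u (γ 0)| + ENNReal.ofReal |u (γ L)| := by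
        rw [← ENNReal.ofReal_add (abs_nonneg _) (abs_nonneg _)]
        exact ENNReal.ofReal_le_ofReal (abs_sub _ _)
    _ ≤ (∫⁻ t in Ico 0 a, g (γ t)) + ∫⁻ t in Ioc b L, g (γ t) := add_le_add h1 h2
    _ = (∫⁻ t in Ico 0 a, Ω.indicator g (γ t)) + ∫⁻ t in Ioc b L, Ω.indicator g (γ t) := by
        congr 1
        · refine setLIntegral_congr_fun measurableSet_Ico fun t ht => (hout t ?_ ?_).symm
          · exact ⟨ht.1, ht.2.le.trans haA.1.2⟩
          · exact fun h => (ha h).not_gt ht.2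
        · refine setLIntegral_congr_fun measurableSet_Ioc fun t ht => (hout t ?_ ?_).symm
          · exact ⟨hbA.1.1.trans ht.1.le, ht.2⟩
          · exact fun h => (hb h).not_gt ht.1
    _ = ∫⁻ t in Ico 0 a ∪ Ioc b L, Ω.indicator g (γ t) := by
        refine (lintegral_union measurableSet_Ioc ?_).symm
        rw [Set.disjoint_left]
        intro t h3 h4
        linarith [h3.2, h4.1]
    _ ≤ ∫⁻ t in Icc 0 L, Ω.indicator g (γ t) := by
        refine lintegral_mono_set (union_subset ?_ ?_)
        · exact fun t ht => ⟨ht.1, ht.2.le.trans haA.1.2⟩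
        · exact fun t ht => ⟨hbA.1.1.trans ht.1.le, ht.2⟩

/-- Twice a Borel representative of a Hajłasz gradient of a Lipschitz function is a weak upper
gradient. -/
theorem IsHajlaszGradient.exists_isWeakUpperGradient {p : ℝ} (hp : 0 < p) {u : X → ℝ} {K : ℝ≥0}
    (hu : LipschitzWith K u) {g : X → ℝ≥0∞} (hg : IsHajlaszGradient μ 1 u g) :
    ∃ G : X → ℝ≥0∞, G =ᵐ[μ] g ∧ IsWeakUpperGradient μ p u fun x => 2 * G x := by
  obtain ⟨hgm, N, hN, H⟩ := hg
  have hN' : μ (N ∪ {x | g x ≠ hgm.mk g x}) = 0 := measure_union_null hN hgm.ae_eq_mk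
  obtain ⟨T, hNT, hTm, hT⟩ := exists_measurable_superset_of_null hN'
  -- The null Borel set `T` contains both the Hajłasz exceptional set and the points where `g`
  -- differs from its representative. With `ρ = ∞` on `T` and `0` elsewhere, a finite integral of
  -- `ρ` means that the curve spends zero time in `T`.
  refine ⟨hgm.mk g, hgm.ae_eq_mk.symm, (hgm.measurable_mk.const_mul 2).aemeasurable,
    T.indicator fun _ => ∞, measurable_const.indicator hTm, fun x => ⟨1, one_pos, ?_⟩, ?_⟩
  · have : ∫⁻ y, (T.indicator (fun _ => ∞) y : ℝ≥0∞) ^ p ∂μ = 0 := by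
      rw [lintegral_eq_zero_iff' (by
        exact ((measurable_const.indicator hTm).pow_const p).aemeasurable)]
      filter_upwards [measure_eq_zero_iff_ae_notMem.1 hT] with y hy
      simp [hy, hp]
    exact (setLIntegral_le_lintegral _ _).trans_lt (by simp [this])
  intro L γ hγ
  contrapose!
  intro hfin
  have hL := hγ.1
  -- `γ` is arbitrary outside `[0, L]`; freezing it at the endpoints makes it continuous, hence
  -- Borel, on the whole line.
  set γ' : ℝ → X := fun t => γ (projIcc 0 L hL.le t) with hγ'
  have heq : ∀ t ∈ Icc 0 L, γ' t = γ t := fun t ht => by rw [hγ']; simp [projIcc_of_mem hL.le ht]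
  have hcont : Continuous γ' :=
    hγ.lipschitzOnWith.continuousOn.domRestrict.comp continuous_projIcc
  have hint : ∀ f : X → ℝ≥0∞, arcLengthIntegral L γ f = ∫⁻ t in Icc 0 L, f (γ' t) := fun f =>
    setLIntegral_congr_fun measurableSet_Icc fun t ht => by simp only [heq t ht]
  rw [hint] at hfin ⊢
  have hS : volume (γ' ⁻¹' T ∩ Icc 0 L) = 0 := by
    by_contra hne
    refine hfin (top_le_iff.1 ?_)
    have e : (fun t => T.indicator (fun _ => (∞ : ℝ≥0∞)) (γ' t)) =
        (γ' ⁻¹' T).indicator fun _ => ∞ := rfl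
    rw [e, lintegral_indicator (hcont.measurable hTm), Measure.restrict_restrict
      (hcont.measurable hTm), setLIntegral_const, ENNReal.top_mul hne]
  have := ofReal_abs_sub_le_lintegral_of_hajlasz hL (v := fun t => u (γ' t))
    (hu.continuous.comp hcont) (h := fun t => hgm.mk g (γ' t))
    (hgm.measurable_mk.comp hcont.measurable) hS ?_
  · rw [lintegral_const_mul' _ _ ENNReal.ofNat_ne_top]
    simpa only [heq 0 (left_mem_Icc.2 hL.le), heq L (right_mem_Icc.2 hL.le)] using this
  · intro s hs hsT t ht htT
    have aux : ∀ x, x ∉ T → x ∉ N ∧ hgm.mk g x = g x := fun x hx => by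
      obtain ⟨h1, h2⟩ := not_or.1 fun h => hx (hNT h)
      exact ⟨h1, (not_not.1 h2).symm⟩
    have h1 := H _ (aux _ hsT).1 _ (aux _ htT).1
    rw [NNReal.coe_one, ENNReal.rpow_one] at h1
    simp only [(aux _ hsT).2, (aux _ htT).2]
    refine h1.trans ?_
    gcongr
    rw [heq s hs, heq t ht]
    exact hγ.edist_le hs ht

theorem variationalCapacity_le_hajlaszCapacity {p : ℝ} (hp : 0 < p) (F Ω : Set X) :
    variationalCapacity μ p F Ω ≤ 2 ^ p * hajlaszCapacity μ 1 p F Ω := by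
  have h2 : (2 : ℝ≥0∞) ^ p ≠ ∞ := by finiteness
  have h2' : (2 : ℝ≥0∞) ^ p ≠ 0 := by simp
  -- The constant is moved to the left so that the infimum stands alone on the right and can be
  -- tested one competitor at a time.
  rw [← ENNReal.div_le_iff' h2' h2]
  refine le_iInf₂ fun u hu => le_iInf₂ fun g hg => ?_
  obtain ⟨⟨K, hK⟩, hF, hΩ⟩ := hu
  rw [holderWith_one] at hK
  obtain ⟨G, hG, hGu⟩ := hg.exists_isWeakUpperGradient hp hK
  rw [ENNReal.div_le_iff' h2' h2]
  refine (iInf₂_le_of_le u ⟨⟨K, hK⟩, hF, hΩ⟩ (iInf₂_le _ hGu)).trans ?_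
  calc ∫⁻ x in Ω, (2 * G x) ^ p ∂μ ≤ ∫⁻ x, (2 * G x) ^ p ∂μ := setLIntegral_le_lintegral _ _
    _ = ∫⁻ x, 2 ^ p * G x ^ p ∂μ := by simp_rw [ENNReal.mul_rpow_of_nonneg _ _ hp.le]
    _ = 2 ^ p * ∫⁻ x, G x ^ p ∂μ := lintegral_const_mul' _ _ h2
    _ = 2 ^ p * ∫⁻ x, g x ^ p ∂μ := by
        congr 1
        exact lintegral_congr_ae (hG.mono fun x hx => by simp only [hx])

end Curves

/-! ### Layer cake formulas -/

theorem setLIntegral_Ioo_ofReal_rpow {s b : ℝ} (hs : 0 < s) (hb : 0 ≤ b) :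
    ∫⁻ t in Ioo 0 b, ENNReal.ofReal (s * t ^ (s - 1)) = ENNReal.ofReal (b ^ s) := by
  rw [setLIntegral_congr Ioo_ae_eq_Ioc, ← ofReal_integral_eq_lintegral_ofReal,
    ← intervalIntegral.integral_of_le hb, intervalIntegral.integral_const_mul,
    integral_rpow (Or.inl (by linarith))]
  · congr 1
    rw [sub_add_cancel, Real.zero_rpow hs.ne', sub_zero]
    field_simp
  · rw [← IntegrableOn, ← intervalIntegrable_iff_integrableOn_Ioc_of_le hb]
    exact (intervalIntegral.intervalIntegrable_rpow' (by linarith)).const_mul s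
  · refine (ae_restrict_mem measurableSet_Ioc).mono fun t ht => ?_
    have := ht.1
    simp only [Pi.zero_apply]
    positivity

/-- The layer cake formula for a power. -/
theorem lintegral_Ioi_indicator_ofReal_lt {s : ℝ} (hs : 0 < s) (a : ℝ≥0∞) :
    ∫⁻ t in Ioi (0 : ℝ), {t | ENNReal.ofReal t < a}.indicator
      (fun t => ENNReal.ofReal (s * t ^ (s - 1))) t = a ^ s := by
  have hfin : ∀ a : ℝ≥0, ∫⁻ t in Ioi (0 : ℝ), {t | ENNReal.ofReal t < a}.indicator
      (fun t => ENNReal.ofReal (s * t ^ (s - 1))) t = (a : ℝ≥0∞) ^ s := by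
    intro a
    have hm : MeasurableSet {t : ℝ | ENNReal.ofReal t < a} :=
      measurableSet_lt ENNReal.measurable_ofReal measurable_const
    rw [lintegral_indicator hm, Measure.restrict_restrict hm]
    have : {t : ℝ | ENNReal.ofReal t < a} ∩ Ioi 0 = Ioo 0 (a : ℝ) := by
      ext t
      simp only [mem_inter_iff, mem_ofPred_eq, mem_Ioi, mem_Ioo]
      rw [and_comm]
      refine and_congr_right fun ht => ?_
      rw [ENNReal.ofReal_lt_iff_lt_toReal ht.le ENNReal.coe_ne_top, ENNReal.coe_toReal]
    rw [this, setLIntegral_Ioo_ofReal_rpow hs a.coe_nonneg,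
      ← ENNReal.ofReal_rpow_of_nonneg a.coe_nonneg hs.le, ENNReal.ofReal_coe_nnreal]
  induction a with
  | coe a => exact hfin a
  | top =>
    rw [ENNReal.top_rpow_of_pos hs]
    refine ENNReal.eq_top_of_forall_nnreal_le fun r => ?_
    have h1 := hfin (r ^ s⁻¹)
    rw [ENNReal.coe_rpow_of_nonneg _ (by positivity), ENNReal.rpow_inv_rpow hs.ne'] at h1
    rw [← h1]
    refine lintegral_mono fun t => indicator_le_indicator_of_subset ?_ (fun _ => zero_le) t
    intro t ht
    exact ENNReal.ofReal_lt_top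

/-- Tonelli on the region under the graph of `h`. The maximal theorem uses it with `φ = 1` for the
maximal function and with `φ = h = f` to recover the power of `f`. -/
theorem lintegral_mul_layer_eq {X : Type*} [MeasurableSpace X] {μ : Measure X} [SFinite μ]
    {φ h : X → ℝ≥0∞} (hφ : Measurable φ)
    (hh : Measurable h) {W : ℝ → ℝ≥0∞} (hW : Measurable W) :
    ∫⁻ x, (φ x * ∫⁻ t in Ioi (0 : ℝ), {t | ENNReal.ofReal t < h x}.indicator W t) ∂μ =
      ∫⁻ t in Ioi (0 : ℝ), W t * ∫⁻ x in {x | ENNReal.ofReal t < h x}, φ x ∂μ := by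
  have hm : MeasurableSet {z : X × ℝ | ENNReal.ofReal z.2 < h z.1} :=
    measurableSet_lt (by fun_prop) (by fun_prop)
  have hFm : Measurable fun z : X × ℝ =>
      {z : X × ℝ | ENNReal.ofReal z.2 < h z.1}.indicator (fun z => φ z.1 * W z.2) z :=
    Measurable.indicator (by fun_prop) hm
  have e1 : ∀ x, φ x * ∫⁻ t in Ioi (0 : ℝ), {t | ENNReal.ofReal t < h x}.indicator W t =
      ∫⁻ t in Ioi (0 : ℝ),
        {z : X × ℝ | ENNReal.ofReal z.2 < h z.1}.indicator (fun z => φ z.1 * W z.2) (x, t) := by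
    intro x
    rw [← lintegral_const_mul _ (hW.indicator
      (measurableSet_lt ENNReal.measurable_ofReal measurable_const))]
    refine lintegral_congr fun t => ?_
    by_cases ht : ENNReal.ofReal t < h x <;> simp [indicator, ht]
  have e2 : ∀ t, W t * ∫⁻ x in {x | ENNReal.ofReal t < h x}, φ x ∂μ =
      ∫⁻ x, {z : X × ℝ | ENNReal.ofReal z.2 < h z.1}.indicator
        (fun z => φ z.1 * W z.2) (x, t) ∂μ := by
    intro t
    rw [← lintegral_indicator (measurableSet_lt measurable_const hh),
      ← lintegral_const_mul _ (hφ.indicator (measurableSet_lt measurable_const hh))]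
    refine lintegral_congr fun x => ?_
    by_cases ht : ENNReal.ofReal t < h x <;> simp [indicator, ht, mul_comm]
  simp_rw [e1, e2]
  exact lintegral_lintegral_swap hFm.aemeasurable

/-! ### The Hardy–Littlewood maximal theorem -/

section Maximal

variable {X : Type*} [MetricSpace X] [MeasurableSpace X]

/-- The uncentered Hardy–Littlewood maximal function. -/
noncomputable def maximalFunction (μ : Measure X) (f : X → ℝ≥0∞) (x : X) : ℝ≥0∞ :=
  ⨆ (y : X) (r : ℝ) (_ : x ∈ ball y r), ⨍⁻ z in ball y r, f z ∂μ

variable {μ : Measure X}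

theorem laverage_le_maximalFunction (f : X → ℝ≥0∞) {x y : X} {r : ℝ} (h : x ∈ ball y r) :
    ⨍⁻ z in ball y r, f z ∂μ ≤ maximalFunction μ f x :=
  le_iSup_of_le y (le_iSup₂_of_le r h le_rfl)

theorem lt_maximalFunction_iff {f : X → ℝ≥0∞} {x : X} {t : ℝ≥0∞} :
    t < maximalFunction μ f x ↔ ∃ y r, x ∈ ball y r ∧ t < ⨍⁻ z in ball y r, f z ∂μ := by
  simp only [maximalFunction, lt_iSup_iff, exists_prop]

/-- As the maximal function is uncentered, a ball that witnesses a large average at one point does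
so at all its points. -/
theorem isOpen_lt_maximalFunction (f : X → ℝ≥0∞) (t : ℝ≥0∞) :
    IsOpen {x | t < maximalFunction μ f x} := by
  have : {x | t < maximalFunction μ f x} =
      ⋃ (y : X) (r : ℝ) (_ : t < ⨍⁻ z in ball y r, f z ∂μ), ball y r := by
    ext x
    simp only [mem_ofPred_eq, lt_maximalFunction_iff, mem_iUnion, exists_prop, and_comm]
  rw [this]
  exact isOpen_iUnion fun y => isOpen_iUnion fun r => isOpen_iUnion fun _ => isOpen_ball

theorem maximalFunction_congr {f g : X → ℝ≥0∞} (h : f =ᵐ[μ] g) :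
    maximalFunction μ f = maximalFunction μ g := by
  funext x
  simp only [maximalFunction]
  congr! 5
  exact laverage_congr (ae_restrict_of_ae h)

theorem sigmaFinite_of_posFiniteOnBalls (hball : PosFiniteOnBalls μ) : SigmaFinite μ := by
  rcases isEmpty_or_nonempty X with h | ⟨⟨x⟩⟩
  · rw [Measure.eq_zero_of_isEmpty μ]; infer_instance
  refine ⟨⟨⟨fun n : ℕ => ball x (n + 1), fun _ => trivial,
    fun n => (hball x (n + 1) (by positivity)).2, ?_⟩⟩⟩
  refine eq_univ_of_forall fun y => mem_iUnion.2 ?_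
  obtain ⟨n, hn⟩ := exists_nat_gt (dist y x)
  exact ⟨n, by rw [mem_ball]; linarith⟩

variable [BorelSpace X]

theorem measurable_maximalFunction (f : X → ℝ≥0∞) : Measurable (maximalFunction μ f) :=
  measurable_of_Ioi fun t => (isOpen_lt_maximalFunction f t).measurableSet

/-- Weak type estimate for families of balls of bounded radii. -/
theorem mul_measure_biUnion_ball_le (hball : PosFiniteOnBalls μ) {c : ℝ≥0}
    (hc : ∀ (x : X) (r : ℝ), 0 < r → μ (ball x (2 * r)) ≤ c * μ (ball x r))
    (f : X → ℝ≥0∞) (t : ℝ≥0∞) (S : Set (X × ℝ)) {R : ℝ} (hR : ∀ b ∈ S, b.2 ≤ R)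
    (hpos : ∀ b ∈ S, 0 < b.2)
    (hS : ∀ b ∈ S, t * μ (ball b.1 b.2) ≤ ∫⁻ z in ball b.1 b.2, f z ∂μ) :
    t * μ (⋃ b ∈ S, ball b.1 b.2) ≤ c ^ 2 * ∫⁻ z, f z ∂μ := by
  have := sigmaFinite_of_posFiniteOnBalls hball
  -- Any enlargement factor above `3` works for Vitali; `7 / 2` leaves room to pass from closed
  -- balls to open balls of factor `4`, which cost two doublings, hence `c ^ 2`.
  obtain ⟨T, hTS, hdisj, hcov⟩ := Vitali.exists_disjoint_subfamily_covering_enlargement_closedBall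
    S (fun b => b.1) (fun b => b.2) R hR (7 / 2) (by norm_num)
  have hdisj' : T.PairwiseDisjoint fun b => ball b.1 b.2 :=
    hdisj.mono fun b => ball_subset_closedBall
  have hcount : T.Countable := by
    have := Measure.countable_meas_pos_of_disjoint_iUnion (μ := μ)
      (As := fun b : T => ball b.1.1 b.1.2) (fun _ => measurableSet_ball)
      (fun a b hab => hdisj' a.2 b.2 (fun h => hab (Subtype.ext h)))
    have huniv : {b : T | 0 < μ (ball b.1.1 b.1.2)} = univ :=
      eq_univ_of_forall fun b => (hball _ _ (hpos _ (hTS b.2))).1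
    rw [huniv, countable_univ_iff] at this
    exact this
  have hfour : ∀ b ∈ S, μ (ball b.1 (4 * b.2)) ≤ c ^ 2 * μ (ball b.1 b.2) := fun b hb => by
    have h0 := hpos b hb
    calc μ (ball b.1 (4 * b.2)) = μ (ball b.1 (2 * (2 * b.2))) := by ring_nf
      _ ≤ c * (c * μ (ball b.1 b.2)) :=
        (hc _ _ (by positivity)).trans (by gcongr; exact hc _ _ h0)
      _ = c ^ 2 * μ (ball b.1 b.2) := by ring
  calc t * μ (⋃ b ∈ S, ball b.1 b.2) ≤ t * μ (⋃ b ∈ T, ball b.1 (4 * b.2)) := by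
        gcongr t * μ ?_
        refine iUnion₂_subset fun a ha => ?_
        obtain ⟨b, hb, hab⟩ := hcov a ha
        refine (ball_subset_closedBall.trans hab).trans ?_
        refine Subset.trans (closedBall_subset_ball ?_) (subset_biUnion_of_mem (u := fun b : X × ℝ =>
          ball b.1 (4 * b.2)) hb)
        linarith [hpos b (hTS hb)]
    _ ≤ t * ∑' b : T, μ (ball b.1.1 (4 * b.1.2)) := by
        gcongr
        exact measure_biUnion_le μ hcount _
    _ ≤ t * ∑' b : T, c ^ 2 * μ (ball b.1.1 b.1.2) := by
        gcongr with b
        exact hfour _ (hTS b.2)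
    _ = c ^ 2 * ∑' b : T, t * μ (ball b.1.1 b.1.2) := by
        rw [ENNReal.tsum_mul_left, ENNReal.tsum_mul_left]; ring
    _ ≤ c ^ 2 * ∑' b : T, ∫⁻ z in ball b.1.1 b.1.2, f z ∂μ := by
        gcongr with b
        exact hS _ (hTS b.2)
    _ = c ^ 2 * ∫⁻ z in ⋃ b ∈ T, ball b.1 b.2, f z ∂μ := by
        rw [lintegral_biUnion hcount (fun _ _ => measurableSet_ball) hdisj']
    _ ≤ c ^ 2 * ∫⁻ z, f z ∂μ := by
        gcongr
        exact Measure.restrict_le_self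

/-- The weak type `(1,1)` estimate for the maximal function. -/
theorem mul_measure_lt_maximalFunction_le (hball : PosFiniteOnBalls μ) {c : ℝ≥0}
    (hc : ∀ (x : X) (r : ℝ), 0 < r → μ (ball x (2 * r)) ≤ c * μ (ball x r))
    (f : X → ℝ≥0∞) (t : ℝ≥0∞) :
    t * μ {x | t < maximalFunction μ f x} ≤ c ^ 2 * ∫⁻ z, f z ∂μ := by
  -- The covering lemma needs bounded radii, so the superlevel set is exhausted by balls of radius
  -- at most `n`.
  set S : ℕ → Set (X × ℝ) := fun n => {b | 0 < b.2 ∧ b.2 ≤ n ∧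
    t * μ (ball b.1 b.2) ≤ ∫⁻ z in ball b.1 b.2, f z ∂μ} with hS
  have hmono : Monotone fun n => ⋃ b ∈ S n, ball b.1 b.2 := fun m n hmn =>
    biUnion_subset_biUnion_left fun b hb => ⟨hb.1, hb.2.1.trans (by exact_mod_cast hmn), hb.2.2⟩
  have hsub : {x | t < maximalFunction μ f x} ⊆ ⋃ n, ⋃ b ∈ S n, ball b.1 b.2 := by
    intro x hx
    obtain ⟨y, r, hxy, ht⟩ := lt_maximalFunction_iff.1 hx
    obtain ⟨n, hn⟩ := exists_nat_ge r
    refine mem_iUnion.2 ⟨n, mem_iUnion₂.2 ⟨(y, r), ⟨pos_of_mem_ball hxy, hn, ?_⟩, hxy⟩⟩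
    rw [setLAverage_eq] at ht
    exact ENNReal.mul_le_of_le_div ht.le
  calc t * μ {x | t < maximalFunction μ f x}
      ≤ t * ⨆ n, μ (⋃ b ∈ S n, ball b.1 b.2) := by
        rw [← hmono.measure_iUnion]
        gcongr
    _ = ⨆ n, t * μ (⋃ b ∈ S n, ball b.1 b.2) := ENNReal.mul_iSup _ _
    _ ≤ c ^ 2 * ∫⁻ z, f z ∂μ := iSup_le fun n =>
        mul_measure_biUnion_ball_le hball hc f t (S n) (R := n) (fun b hb => hb.2.1)
          (fun b hb => hb.1) (fun b hb => hb.2.2)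

/-- The weak type estimate, with the function truncated from below. -/
theorem mul_measure_two_mul_lt_maximalFunction_le (hball : PosFiniteOnBalls μ) {c : ℝ≥0}
    (hc : ∀ (x : X) (r : ℝ), 0 < r → μ (ball x (2 * r)) ≤ c * μ (ball x r))
    {f : X → ℝ≥0∞} (hf : Measurable f) (t : ℝ≥0∞) :
    t * μ {x | 2 * t < maximalFunction μ f x} ≤ c ^ 2 * ∫⁻ z in {z | t < f z}, f z ∂μ := by
  rw [← lintegral_indicator (measurableSet_lt measurable_const hf)]
  refine le_trans ?_ (mul_measure_lt_maximalFunction_le hball hc _ t)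
  gcongr t * μ ?_
  intro x hx
  obtain ⟨y, r, hxy, ht⟩ := lt_maximalFunction_iff.1 hx
  refine lt_maximalFunction_iff.2 ⟨y, r, hxy, ?_⟩
  have hr := pos_of_mem_ball hxy
  by_contra! hcon
  refine ht.not_ge ?_
  -- Discarding the values of `f` up to `t` lowers an average by at most `t`, so an average above `2
  -- * t` stays above `t`.
  have hle : ∀ z, f z ≤ {z | t < f z}.indicator f z + t := fun z => by
    by_cases h : t < f z
    · rw [indicator_of_mem (by exact h)]; exact le_self_add
    · exact (not_lt.1 h).trans le_add_self
  calc ⨍⁻ z in ball y r, f z ∂μ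
      ≤ ⨍⁻ z in ball y r, ({z | t < f z}.indicator f z + t) ∂μ := by
        rw [setLAverage_eq, setLAverage_eq]
        gcongr with z
        exact hle z
    _ = (⨍⁻ z in ball y r, {z | t < f z}.indicator f z ∂μ) + t := by
        rw [setLAverage_eq, setLAverage_eq, lintegral_add_right _ measurable_const,
          ENNReal.add_div, setLIntegral_const,
          ENNReal.mul_div_cancel_right (hball y r hr).1.ne' (hball y r hr).2.ne]
    _ ≤ 2 * t := by rw [two_mul]; gcongr

/-- The Hardy–Littlewood maximal theorem. -/
theorem exists_lintegral_maximalFunction_rpow_le (hball : PosFiniteOnBalls μ)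
    (hdoubling : IsDoublingOnBalls μ) {s : ℝ} (hs : 1 < s) :
    ∃ C : ℝ≥0, ∀ f : X → ℝ≥0∞, AEMeasurable f μ →
      ∫⁻ x, maximalFunction μ f x ^ s ∂μ ≤ C * ∫⁻ x, f x ^ s ∂μ := by
  have := sigmaFinite_of_posFiniteOnBalls hball
  obtain ⟨c, -, hc⟩ := hdoubling
  have hs0 : 0 < s := by linarith
  refine ⟨2 ^ s * (c ^ 2 * (s / (s - 1)).toNNReal), fun f hf => ?_⟩
  wlog hfm : Measurable f generalizing f
  · have e : ∫⁻ x, f x ^ s ∂μ = ∫⁻ x, hf.mk f x ^ s ∂μ :=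
      lintegral_congr_ae (hf.ae_eq_mk.fun_comp fun a => a ^ s)
    rw [maximalFunction_congr hf.ae_eq_mk, e]
    exact this _ hf.measurable_mk.aemeasurable hf.measurable_mk
  have hM : Measurable fun x => maximalFunction μ f x / 2 :=
    (measurable_maximalFunction f).div_const 2
  have hW : Measurable fun t : ℝ => ENNReal.ofReal (s * t ^ (s - 1)) := by fun_prop
  have hW' : Measurable fun t : ℝ => ENNReal.ofReal ((s - 1) * t ^ (s - 1 - 1)) := by fun_prop
  -- Halving the maximal function matches the level `2 * t` in the truncated weak type estimate; the
  -- factor `2 ^ s` is restored at the end.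
  have key : ∫⁻ x, (maximalFunction μ f x / 2) ^ s ∂μ ≤
      c ^ 2 * ENNReal.ofReal (s / (s - 1)) * ∫⁻ x, f x ^ s ∂μ := by
    calc ∫⁻ x, (maximalFunction μ f x / 2) ^ s ∂μ
        = ∫⁻ x, (1 * ∫⁻ t in Ioi (0 : ℝ), {t | ENNReal.ofReal t <
            maximalFunction μ f x / 2}.indicator
              (fun t => ENNReal.ofReal (s * t ^ (s - 1))) t) ∂μ := by
          refine lintegral_congr fun x => ?_
          rw [one_mul, lintegral_Ioi_indicator_ofReal_lt hs0]
      _ = ∫⁻ t in Ioi (0 : ℝ), ENNReal.ofReal (s * t ^ (s - 1)) *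
            ∫⁻ x in {x | ENNReal.ofReal t < maximalFunction μ f x / 2}, 1 ∂μ :=
          lintegral_mul_layer_eq measurable_const hM hW
      _ ≤ ∫⁻ t in Ioi (0 : ℝ), c ^ 2 * ENNReal.ofReal (s / (s - 1)) *
            (ENNReal.ofReal ((s - 1) * t ^ (s - 1 - 1)) *
              ∫⁻ x in {x | ENNReal.ofReal t < f x}, f x ∂μ) := by
          refine setLIntegral_mono' measurableSet_Ioi fun t ht => ?_
          have ht0 : (0 : ℝ) < t := ht
          have hset : {x | ENNReal.ofReal t < maximalFunction μ f x / 2} =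
              {x | 2 * ENNReal.ofReal t < maximalFunction μ f x} := by
            ext x
            simp only [mem_ofPred_eq]
            rw [ENNReal.lt_div_iff_mul_lt (Or.inl two_ne_zero) (Or.inl ENNReal.ofNat_ne_top),
              mul_comm]
          -- One factor `t` is spent on the weak type estimate. What remains is the layer cake
          -- weight for the exponent `s - 1`, which later yields `f * f ^ (s - 1)`.
          have hwt : ENNReal.ofReal (s * t ^ (s - 1)) = ENNReal.ofReal (s / (s - 1)) *
              ENNReal.ofReal ((s - 1) * t ^ (s - 1 - 1)) * ENNReal.ofReal t := by
            have h1 : 0 < s - 1 := by linarith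
            rw [← ENNReal.ofReal_mul (by positivity), ← ENNReal.ofReal_mul (by positivity)]
            congr 1
            rw [Real.rpow_sub_one ht0.ne' (s - 1)]
            field_simp
          rw [setLIntegral_one, hset, hwt]
          calc _ = ENNReal.ofReal (s / (s - 1)) * ENNReal.ofReal ((s - 1) * t ^ (s - 1 - 1)) *
                (ENNReal.ofReal t * μ {x | 2 * ENNReal.ofReal t < maximalFunction μ f x}) := by
                ring
            _ ≤ ENNReal.ofReal (s / (s - 1)) * ENNReal.ofReal ((s - 1) * t ^ (s - 1 - 1)) *
                (c ^ 2 * ∫⁻ x in {x | ENNReal.ofReal t < f x}, f x ∂μ) := by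
                gcongr _ * ?_
                exact mul_measure_two_mul_lt_maximalFunction_le hball hc hfm _
            _ = _ := by ring
      _ = c ^ 2 * ENNReal.ofReal (s / (s - 1)) *
            ∫⁻ t in Ioi (0 : ℝ), ENNReal.ofReal ((s - 1) * t ^ (s - 1 - 1)) *
              ∫⁻ x in {x | ENNReal.ofReal t < f x}, f x ∂μ :=
          lintegral_const_mul' _ _ (by finiteness)
      _ = c ^ 2 * ENNReal.ofReal (s / (s - 1)) * ∫⁻ x, f x ^ s ∂μ := by
          rw [← lintegral_mul_layer_eq hfm hfm hW']
          congr 1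
          refine lintegral_congr fun x => ?_
          rw [lintegral_Ioi_indicator_ofReal_lt (by linarith)]
          nth_rw 1 [← ENNReal.rpow_one (f x)]
          rw [← ENNReal.rpow_add_of_nonneg _ _ zero_le_one (by linarith), add_sub_cancel]
  have h2 : (2 : ℝ≥0∞) ^ s ≠ ∞ := by finiteness
  calc ∫⁻ x, maximalFunction μ f x ^ s ∂μ
      = ∫⁻ x, 2 ^ s * (maximalFunction μ f x / 2) ^ s ∂μ := by
        refine lintegral_congr fun x => ?_
        rw [← ENNReal.mul_rpow_of_nonneg _ _ hs0.le,
          ENNReal.mul_div_cancel two_ne_zero ENNReal.ofNat_ne_top]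
    _ = 2 ^ s * ∫⁻ x, (maximalFunction μ f x / 2) ^ s ∂μ := lintegral_const_mul' _ _ h2
    _ ≤ 2 ^ s * (c ^ 2 * ENNReal.ofReal (s / (s - 1)) * ∫⁻ x, f x ^ s ∂μ) := by gcongr
    _ = _ := by
        rw [ENNReal.ofReal]
        push_cast
        rw [ENNReal.coe_rpow_of_nonneg _ hs0.le, ENNReal.coe_ofNat]
        ring

end Maximal

/-! ### From mean oscillation to Hajłasz gradients -/

/-- Averages over comparable sets differ by at most the mean oscillation. -/
theorem edist_setAverage_le_mul_meanOscillation {X : Type*} [MeasurableSpace X]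
    {μ : Measure X} {u : X → ℝ} {D B : Set X} (hDB : D ⊆ B)
    (hD0 : μ D ≠ 0) (hBt : μ B ≠ ∞) (hu : IntegrableOn u B μ)
    {k : ℝ≥0∞} (hk : μ B ≤ k * μ D) :
    edist (⨍ y in D, u y ∂μ) (⨍ y in B, u y ∂μ) ≤ k * meanOscillation μ u B := by
  have hDt : μ D ≠ ∞ := measure_ne_top_of_subset hDB hBt
  have hB0 : μ B ≠ 0 := fun h => hD0 (measure_mono_null hDB h)
  rw [meanOscillation, if_pos hu]
  set b := ⨍ y in B, u y ∂μ with hb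
  have hfin : IsFiniteMeasure (μ.restrict D) := ⟨by simpa using hDt.lt_top⟩
  have hne : NeZero (μ.restrict D) := ⟨by simpa [Measure.restrict_eq_zero] using hD0⟩
  have h1 : (⨍ y in D, u y ∂μ) - b = ⨍ y in D, (u y - b) ∂μ := by
    rw [setAverage_eq, setAverage_eq, integral_sub (hu.mono_set hDB) (integrable_const b),
      setIntegral_const, smul_sub, smul_smul, inv_mul_cancel₀, one_smul]
    exact (ENNReal.toReal_pos hD0 hDt).ne'
  have h2 : edist (⨍ y in D, u y ∂μ) b ≤ ⨍⁻ y in D, ENNReal.ofReal |u y - b| ∂μ := by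
    rw [edist_eq_enorm_sub, h1, average]
    refine (enorm_integral_le_lintegral_enorm _).trans (le_of_eq ?_)
    rw [laverage]
    simp_rw [← Real.norm_eq_abs, ofReal_norm]
  refine h2.trans ?_
  rw [setLAverage_eq, setLAverage_eq]
  refine ENNReal.div_le_of_le_mul ?_
  set I := ∫⁻ y in B, ENNReal.ofReal |u y - b| ∂μ with hI
  calc ∫⁻ y in D, ENNReal.ofReal |u y - b| ∂μ ≤ I := lintegral_mono_set hDB
    _ = I / μ B * μ B := (ENNReal.div_mul_cancel hB0 hBt).symm
    _ ≤ I / μ B * (k * μ D) := by gcongr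
    _ = k * (I / μ B) * μ D := by ring

section Poincare

variable {X : Type*} [MetricSpace X] [MeasurableSpace X] [BorelSpace X] {μ : Measure X}

theorem LipschitzWith.integrableOn_ball (hball : PosFiniteOnBalls μ) {K : ℝ≥0} {u : X → ℝ}
    (hu : LipschitzWith K u) {x : X} {r : ℝ} (hr : 0 < r) : IntegrableOn u (ball x r) μ := by
  refine IntegrableOn.of_bound (hball x r hr).2 hu.continuous.measurable.aestronglyMeasurable
    (|u x| + K * r) ((ae_restrict_mem measurableSet_ball).mono fun y hy => ?_)
  have h1 := hu.dist_le_mul y x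
  rw [Real.dist_eq] at h1
  have h2 : (K : ℝ) * dist y x ≤ K * r := by gcongr; exact (mem_ball.1 hy).le
  rw [Real.norm_eq_abs]
  have h3 := abs_sub_abs_le_abs_sub (u y) (u x)
  linarith

/-- The mean over `B(x, r)` is within `K * r` of `u x`. Convergence thus holds at every point, and
no null set of non-Lebesgue points arises. -/
theorem tendsto_setAverage_ball (hball : PosFiniteOnBalls μ) {K : ℝ≥0} {u : X → ℝ}
    (hu : LipschitzWith K u) (x : X) {r : ℕ → ℝ} (hr : ∀ n, 0 < r n)
    (hr0 : Filter.Tendsto r Filter.atTop (nhds 0)) :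
    Filter.Tendsto (fun n => ⨍ y in ball x (r n), u y ∂μ) Filter.atTop (nhds (u x)) := by
  rw [tendsto_iff_dist_tendsto_zero]
  refine squeeze_zero (fun _ => dist_nonneg) (g := fun n => K * r n) (fun n => ?_)
    (by simpa using hr0.const_mul (K : ℝ))
  have hmem : (⨍ y in ball x (r n), u y ∂μ) ∈ closedBall (u x) (K * r n) := by
    refine (convex_closedBall _ _).set_average_mem isClosed_closedBall (hball x _ (hr n)).1.ne'
      (hball x _ (hr n)).2.ne ?_ (hu.integrableOn_ball hball (hr n))
    refine (ae_restrict_mem measurableSet_ball).mono fun y hy => ?_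
    exact (hu.dist_le_mul y x).trans (by gcongr; exact (mem_ball.1 hy).le)
  exact hmem

/-- Telescoping over balls shrinking to a point. -/
theorem edist_setAverage_ball_le (hball : PosFiniteOnBalls μ) {c : ℝ≥0}
    (hc : ∀ (x : X) (r : ℝ), 0 < r → μ (ball x (2 * r)) ≤ c * μ (ball x r))
    {K : ℝ≥0} {u : X → ℝ} (hu : LipschitzWith K u) {x : X} {A : ℝ≥0∞}
    (hA : ∀ r, 0 < r → meanOscillation μ u (ball x r) ≤ ENNReal.ofReal r * A)
    {d : ℝ} (hd : 0 < d) :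
    edist (⨍ y in ball x d, u y ∂μ) (u x) ≤ 2 * c * A * ENNReal.ofReal d := by
  have hr : ∀ n : ℕ, 0 < d * (1 / 2) ^ n := fun n => by positivity
  have ht : Filter.Tendsto (fun n : ℕ => d * (1 / 2 : ℝ) ^ n) Filter.atTop (nhds 0) := by
    simpa using (tendsto_pow_atTop_nhds_zero_of_lt_one (r := (1 / 2 : ℝ)) (by norm_num)
      (by norm_num)).const_mul d
  -- Radii are halved: consecutive means differ by at most `c` times the oscillation on the larger
  -- ball, and the geometric series produces the factor `2`.
  have := edist_le_tsum_of_edist_le_of_tendsto₀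
    (f := fun n : ℕ => ⨍ y in ball x (d * (1 / 2) ^ n), u y ∂μ)
    (fun n : ℕ => c * A * ENNReal.ofReal d * 2⁻¹ ^ n) (fun n => ?_)
    (tendsto_setAverage_ball hball hu x hr ht)
  · rw [ENNReal.tsum_mul_left, ENNReal.tsum_geometric, ENNReal.one_sub_inv_two, inv_inv] at this
    simp only [pow_zero, mul_one] at this
    refine this.trans (le_of_eq ?_)
    ring
  · have hsub : ball x (d * (1 / 2) ^ n.succ) ⊆ ball x (d * (1 / 2) ^ n) := by
      refine ball_subset_ball ?_
      rw [pow_succ]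
      nlinarith [hr n]
    have h2 : μ (ball x (d * (1 / 2) ^ n)) ≤ c * μ (ball x (d * (1 / 2) ^ n.succ)) := by
      refine le_trans (le_of_eq ?_) (hc x _ (hr n.succ))
      congr 2
      rw [pow_succ]; ring
    refine (edist_comm _ _).trans_le ((edist_setAverage_le_mul_meanOscillation hsub
      (hball _ _ (hr _)).1.ne' (hball _ _ (hr _)).2.ne
      (hu.integrableOn_ball hball (hr n)) h2).trans ?_)
    calc c * meanOscillation μ u (ball x (d * (1 / 2) ^ n))
        ≤ c * (ENNReal.ofReal (d * (1 / 2) ^ n) * A) := by gcongr; exact hA _ (hr n)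
      _ = c * A * ENNReal.ofReal d * 2⁻¹ ^ n := by
          rw [ENNReal.ofReal_mul hd.le, ENNReal.ofReal_pow (by norm_num), one_div,
            ENNReal.ofReal_inv_of_pos two_pos, ENNReal.ofReal_ofNat]
          ring

/-- A Lipschitz function whose mean oscillations over balls are controlled linearly by the radius
satisfies a pointwise Hajłasz inequality. -/
theorem edist_le_of_meanOscillation_le (hball : PosFiniteOnBalls μ) {c : ℝ≥0} (hc1 : 1 ≤ c)
    (hc : ∀ (x : X) (r : ℝ), 0 < r → μ (ball x (2 * r)) ≤ c * μ (ball x r))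
    {K : ℝ≥0} {u : X → ℝ} (hu : LipschitzWith K u) {A : X → ℝ≥0∞}
    (hA : ∀ x r, 0 < r → meanOscillation μ u (ball x r) ≤ ENNReal.ofReal r * A x) (x y : X) :
    edist (u x) (u y) ≤ 6 * c ^ 2 * edist x y * (A x + A y) := by
  rcases eq_or_ne x y with rfl | hxy
  · simp
  set d := dist x y with hd
  have hd0 : 0 < d := dist_pos.2 hxy
  have h2d : 0 < 2 * d := by positivity
  have hsub : ball y d ⊆ ball x (2 * d) := by
    refine ball_subset_ball' ?_
    rw [dist_comm y x]; linarith
  -- Two doublings, since `B(x, 2d)` lies in `B(y, 4d)`; the larger ball links the means around `x`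
  -- and `y`.
  have hmeas : μ (ball x (2 * d)) ≤ (c : ℝ≥0∞) ^ 2 * μ (ball y d) := by
    calc μ (ball x (2 * d)) ≤ μ (ball y (2 * (2 * d))) := by
          refine measure_mono (ball_subset_ball' ?_); linarith
      _ ≤ c * (c * μ (ball y d)) :=
        (hc _ _ h2d).trans (by gcongr; exact hc _ _ hd0)
      _ = _ := by ring
  have i1 := edist_setAverage_ball_le hball hc hu (hA x) hd0
  have i2 := edist_setAverage_ball_le hball hc hu (hA y) hd0
  have hosc : meanOscillation μ u (ball x (2 * d)) ≤ 2 * ENNReal.ofReal d * A x := by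
    refine (hA x _ h2d).trans (le_of_eq ?_)
    rw [ENNReal.ofReal_mul two_pos.le, ENNReal.ofReal_ofNat]
  have i3 := edist_setAverage_le_mul_meanOscillation (ball_subset_ball (by linarith : d ≤ 2 * d))
    (hball x d hd0).1.ne' (hball x _ h2d).2.ne
    (hu.integrableOn_ball hball h2d) (hc x d hd0)
  have i4 := edist_setAverage_le_mul_meanOscillation hsub
    (hball y d hd0).1.ne' (hball x _ h2d).2.ne
    (hu.integrableOn_ball hball h2d) hmeas
  have hcc : (c : ℝ≥0∞) ≤ (c : ℝ≥0∞) ^ 2 := by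
    exact_mod_cast le_self_pow₀ hc1 two_ne_zero
  rw [edist_dist x y, ← hd]
  set D := ENNReal.ofReal d
  calc edist (u x) (u y) ≤ edist (u x) (⨍ z in ball x d, u z ∂μ) +
        edist (⨍ z in ball x d, u z ∂μ) (⨍ z in ball x (2 * d), u z ∂μ) +
        edist (⨍ z in ball x (2 * d), u z ∂μ) (⨍ z in ball y d, u z ∂μ) +
        edist (⨍ z in ball y d, u z ∂μ) (u y) := by
        refine (edist_triangle4 _ (⨍ z in ball x (2 * d), u z ∂μ)
          (⨍ z in ball y d, u z ∂μ) _).trans ?_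
        gcongr
        exact edist_triangle _ _ _
    -- Three of the four links are charged to `A x`, each costing `2 * c ^ 2 * D`, whence the
    -- constant `6`; the last is charged to `A y`.
    _ ≤ 2 * c ^ 2 * A x * D + c ^ 2 * (2 * D * A x) + c ^ 2 * (2 * D * A x) +
        2 * c ^ 2 * A y * D := by
        rw [edist_comm (u x), edist_comm (⨍ z in ball x (2 * d), u z ∂μ) (⨍ z in ball y d, u z ∂μ)]
        gcongr
        · exact i1.trans (by gcongr)
        · exact i3.trans (by gcongr)
        · exact i4.trans (by gcongr)
        · exact i2.trans (by gcongr)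
    _ = 6 * c ^ 2 * D * A x + 2 * c ^ 2 * D * A y := by ring
    _ ≤ 6 * c ^ 2 * D * A x + 6 * c ^ 2 * D * A y := by gcongr; norm_num
    _ = 6 * c ^ 2 * D * (A x + A y) := by ring

/-- The Poincaré inequality and the strict inequality `q < p` enter here: the former turns an upper
gradient into a pointwise bound by a maximal function, the latter makes that maximal function
bounded on `L^(p/q)`. -/
theorem exists_hajlaszCapacity_le_variationalCapacity (hball : PosFiniteOnBalls μ)
    (hdoubling : IsDoublingOnBalls μ) {p q : ℝ} (hq : 1 ≤ q) (hqp : q < p)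
    (hP : SupportsPoincare μ q) :
    ∃ C : ℝ≥0, 0 < C ∧ ∀ F Ω : Set X, IsOpen Ω →
      hajlaszCapacity μ 1 p F Ω ≤ C * variationalCapacity μ p F Ω := by
  have hq0 : 0 < q := by linarith
  have hp0 : 0 < p := by linarith
  obtain ⟨C₁, hC₁⟩ := exists_lintegral_maximalFunction_rpow_le hball hdoubling
    (s := p / q) ((one_lt_div hq0).2 hqp)
  obtain ⟨c, hc1, hc⟩ := hdoubling
  obtain ⟨C₂, l, hC₂, hl, hP⟩ := hP
  set k : ℝ≥0 := 6 * c ^ 2 * (2 * C₂) with hk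
  -- The summand `1` keeps the constant positive even if `C₁ = 0`.
  refine ⟨k ^ p * C₁ + 1, by positivity, fun F Ω hΩ => ?_⟩
  have hC0 : ((k ^ p * C₁ + 1 : ℝ≥0) : ℝ≥0∞) ≠ 0 := by simp
  rw [← ENNReal.div_le_iff' hC0 ENNReal.coe_ne_top]
  refine le_iInf₂ fun u hu => le_iInf₂ fun g hg => ?_
  rw [ENNReal.div_le_iff' hC0 ENNReal.coe_ne_top]
  obtain ⟨⟨K, hK⟩, hF, hu0⟩ := hu
  -- The cut-off is needed because the Hajłasz energy is integrated over all of `X` but the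
  -- variational one only over `Ω`; lowering the exponent makes the `q`-Poincaré inequality
  -- applicable.
  have hg' := (hg.indicator hΩ hu0).mono_exponent hball hq0.le hqp.le
  set f : X → ℝ≥0∞ := fun x => Ω.indicator g x ^ q with hf
  have hfm : AEMeasurable f μ := hg'.1.pow_const q
  set A : X → ℝ≥0∞ := fun x => maximalFunction μ f x ^ (1 / q) with hA
  have hAm : Measurable A := (measurable_maximalFunction f).pow_const _
  have hosc : ∀ x r, 0 < r →
      meanOscillation μ u (ball x r) ≤ ENNReal.ofReal r * (2 * C₂ * A x) := by
    intro x r hr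
    refine (hP x r hr u hK.continuous.measurable.aemeasurable _ hg').trans ?_
    have h1 : ediam (ball x r) ≤ 2 * ENNReal.ofReal r := by
      rw [← eball_ofReal]; exact ediam_eball_le
    -- The dilation `l` is free: the maximal function dominates averages over all balls containing
    -- `x`, whatever their radius.
    calc C₂ * ediam (ball x r) * (⨍⁻ y in ball x (l * r), Ω.indicator g y ^ q ∂μ) ^ (1 / q)
        ≤ C₂ * (2 * ENNReal.ofReal r) * A x := by
          gcongr
          exact ENNReal.rpow_le_rpow
            (laverage_le_maximalFunction f (mem_ball_self (by positivity))) (by positivity)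
      _ = _ := by ring
  have hgrad : IsHajlaszGradient μ 1 u fun x => k * A x := by
    refine ⟨(hAm.const_mul _).aemeasurable, ∅, measure_empty, fun x _ y _ => ?_⟩
    rw [NNReal.coe_one, ENNReal.rpow_one, ← Real.dist_eq, ← edist_dist]
    refine (edist_le_of_meanOscillation_le hball hc1.le hc hK hosc x y).trans (le_of_eq ?_)
    rw [hk]; push_cast; ring
  refine (iInf₂_le_of_le u ⟨⟨K, holderWith_one.2 hK⟩, hF, hu0⟩ (iInf₂_le _ hgrad)).trans ?_
  calc ∫⁻ x, (k * A x) ^ p ∂μ = ∫⁻ x, k ^ p * maximalFunction μ f x ^ (p / q) ∂μ := by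
        refine lintegral_congr fun x => ?_
        rw [ENNReal.mul_rpow_of_nonneg _ _ hp0.le, hA, ← ENNReal.rpow_mul, one_div_mul_eq_div]
    _ = k ^ p * ∫⁻ x, maximalFunction μ f x ^ (p / q) ∂μ :=
        lintegral_const_mul' _ _ (by finiteness)
    _ ≤ k ^ p * (C₁ * ∫⁻ x, f x ^ (p / q) ∂μ) := by gcongr; exact hC₁ f hfm
    _ = k ^ p * C₁ * ∫⁻ x in Ω, g x ^ p ∂μ := by
        rw [mul_assoc, ← lintegral_indicator hΩ.measurableSet]
        congr 2
        refine lintegral_congr fun x => ?_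
        rw [hf, ← ENNReal.rpow_mul, mul_div_cancel₀ _ hq0.ne']
        by_cases hx : x ∈ Ω <;> simp [hx, hp0]
    _ ≤ ↑(k ^ p * C₁ + 1) * ∫⁻ x in Ω, g x ^ p ∂μ := by
        gcongr
        push_cast
        rw [← ENNReal.coe_rpow_of_nonneg _ hp0.le]
        exact le_self_add

/-! ### Transfer of the density condition -/

/-- Comparable set functions yield equivalent density conditions. -/
theorem exists_mul_le_of_comparable {ι : Type*} {P : ι → Prop} {V₁ V₂ H₁ H₂ : ι → ℝ≥0∞}
    {a b : ℝ≥0} (ha : 0 < a) (hb : 0 < b) (h₁ : ∀ i, V₁ i ≤ a * H₁ i) (h₂ : ∀ i, H₂ i ≤ b * V₂ i)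
    (h : ∃ c : ℝ≥0, 0 < c ∧ ∀ i, P i → c * H₁ i ≤ H₂ i) :
    ∃ c : ℝ≥0, 0 < c ∧ ∀ i, P i → c * V₁ i ≤ V₂ i := by
  obtain ⟨c, hc, H⟩ := h
  refine ⟨c / (a * b), by positivity, fun i hi => ?_⟩
  have hab : ((a * b : ℝ≥0) : ℝ≥0∞) ≠ 0 := by exact_mod_cast (mul_pos ha hb).ne'
  rw [ENNReal.coe_div (mul_pos ha hb).ne', mul_comm, ← mul_div_assoc]
  refine ENNReal.div_le_of_le_mul ?_
  calc V₁ i * c ≤ a * H₁ i * c := by gcongr; exact h₁ i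
    _ = a * (c * H₁ i) := by ring
    _ ≤ a * (b * V₂ i) := by gcongr _ * ?_; exact (H i hi).trans (h₂ i)
    _ = V₂ i * (a * b : ℝ≥0) := by push_cast; ring

end Poincare

theorem corollaryc {X : Type*} [MetricSpace X] [Nontrivial X] [MeasurableSpace X] [BorelSpace X]
    (μ : Measure X) (hball : PosFiniteOnBalls μ) (hdoubling : IsDoublingOnBalls μ)
    (p q : ℝ) (hq : 1 ≤ q) (hqp : q < p) (hP : SupportsPoincare μ q)
    (E : Set X) (hE : IsClosed E) :
    HajlaszCapacityDensity μ 1 p E ↔ VariationalCapacityDensity μ p E := by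
  obtain ⟨D, hD, hHV⟩ := exists_hajlaszCapacity_le_variationalCapacity hball hdoubling hq hqp hP
  have hp : 0 < p := by linarith
  have hVH : ∀ F Ω : Set X,
      variationalCapacity μ p F Ω ≤ ((2 ^ p : ℝ≥0) : ℝ≥0∞) * hajlaszCapacity μ 1 p F Ω := by
    intro F Ω
    rw [ENNReal.coe_rpow_of_nonneg _ hp.le, ENNReal.coe_ofNat]
    exact variationalCapacity_le_hajlaszCapacity hp F Ω
  have h2 : (0 : ℝ≥0) < 2 ^ p := by positivity
  have uncurry : ∀ H : Set X → Set X → ℝ≥0∞,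
      (∃ c : ℝ≥0, 0 < c ∧ ∀ x ∈ E, ∀ r : ℝ, 0 < r → ENNReal.ofReal r < ediam E / 8 →
        c * H (closure (ball x r)) (ball x (2 * r)) ≤
          H (E ∩ closure (ball x r)) (ball x (2 * r))) ↔
      ∃ c : ℝ≥0, 0 < c ∧ ∀ i : X × ℝ,
        (i.1 ∈ E ∧ 0 < i.2 ∧ ENNReal.ofReal i.2 < ediam E / 8) →
        c * H (closure (ball i.1 i.2)) (ball i.1 (2 * i.2)) ≤
          H (E ∩ closure (ball i.1 i.2)) (ball i.1 (2 * i.2)) := fun H => by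
    simp only [Prod.forall, and_imp]
    refine exists_congr fun c => and_congr_right fun _ => forall_congr' fun x => ?_
    exact ⟨fun h r hx => h hx r, fun h hx r => h r hx⟩
  rw [HajlaszCapacityDensity, VariationalCapacityDensity, uncurry (hajlaszCapacity μ 1 p),
    uncurry (variationalCapacity μ p)]
  -- Each implication uses both comparisons, one for the full closed ball and the other for its
  -- intersection with `E`; the converse swaps their roles.
  constructor
  · exact exists_mul_le_of_comparable h2 hD (fun i => hVH _ _) fun i => hHV _ _ isOpen_ball
  · exact exists_mul_le_of_comparable hD h2 (fun i => hHV _ _ isOpen_ball) fun i => hVH _ _
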